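/- Let $(W,S)$ be a Coxeter system with $S$ finite and non-empty ($W$ may be infinite or finite), with Coxeter matrix $(m_{st})$. Let $V$ be a finite-dimensional real vector space with a symmetric bilinear form $B$, and let $\Delta=\{\alpha_s : s\in S\}\subset V$ be a simple system for $(W,S)$: the $\alpha_s$ are positively linearly independent (if $\sum_s a_s\alpha_s=0$ with all $a_s\ge 0$, then all $a_s=0$), $B(\alpha_s,\alpha_s)=1$, and for $s\neq t$ one has $B(\alpha_s,\alpha_t)=-\cos(\pi/m_{st})$ if $m_{st}<\infty$ and $B(\alpha_s,\alpha_t)\le -1$ if $m_{st}=\infty$. Let $W$ act linearly on $V$ by $s(v)=v-2B(\alpha_s,v)\alpha_s$ for $s\in S$. For $A\subseteq V$ let $\operatorname{cone}(A)$ be the set of non-negative linear combinations of elements of $A$. Put $\Phi=W(\Delta)$, $\Phi^+=\Phi\cap\operatorname{cone}(\Delta)$, $\Phi^-=-\Phi^+$, $\operatorname{cone}_\Phi(A)=\operatorname{cone}(A)\cap\Phi$, $N(w)=\Phi^+\cap w(\Phi^-)$ for $w\in W$, and $N(X)=\bigcup_{x\in X}N(x)$ for $X\subseteq W$. Let $V_1=\{v\in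 V : \varphi(v)=1\}$, where $\varphi$ is a linear form on $V$ that is positive on $\Phi^+$. For $\beta\in\Phi$ let $\widehat\beta=\beta/\varphi(\beta)$ be the point of $\mathbb{R}\beta\cap V_1$, and for $A\subseteq\Phi$ put $\widehat A=\{\widehat\beta:\beta\in A\}$; write $\widehat N(X)$ for $\widehat{N(X)}$. Let $E$ be the set of accumulation points of $\widehat\Phi$ (the limit roots); $\operatorname{conv}(E)$ is the imaginary convex body. Let $\le$ be the right weak order on $W$: $u\le v$ if and only if some reduced word for $u$ is a prefix of some reduced word for $v$. Then for every $X\subseteq W$ the following statements are equivalent: (i) the join (least upper bound) $\bigvee X$ of $X$ in $(W,\le)$ exists; (ii) $X$ is bounded: there is $g\in W$ such that $x\le g$ for all $x\in X$; (iii) $X$ is finite and $\operatorname{conv}(\widehat N(X))\cap\operatorname{conv}(E)=\varnothing$; (iv) $X$ is finite and $\operatorname{conv}(\widehat N(X))$ and $\operatorname{conv}(E)$ are strictly separated by an affine hyperplane of $V$, that is, they lie in opposite open half-spaces bounded by it. In this case, $N(\bigvee X)=\operatorname{cone}_\Phi(N(X))$. -/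

import Mathlib

noncomputable section

namespace CoxeterJoin

/-! ### Right weak order, bounded sets, joins -/

section WeakOrder

variable {S W : Type*} [Group W] {M : CoxeterMatrix S}

/-- The right weak order on `W`: `u ≤ v` iff some reduced word for `u` is a prefix of some reduced
word for `v`. -/
def WeakLE (cs : CoxeterSystem M W) (u v : W) : Prop :=
  ∃ ω ω' : List S, cs.IsReduced ω ∧ cs.IsReduced ω' ∧
    cs.wordProd ω = u ∧ cs.wordProd ω' = v ∧ ω <+: ω'

/-- `g` is an upper bound of `X` in the right weak order. -/
def IsUpperBound (cs : CoxeterSystem M W) (X : Set W) (g : W) : Prop :=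
  ∀ x ∈ X, WeakLE cs x g

/-- `X` is bounded in `W`. -/
def Bounded (cs : CoxeterSystem M W) (X : Set W) : Prop :=
  ∃ g, IsUpperBound cs X g

/-- `g` is the join (least upper bound) of `X` in the right weak order. -/
def IsJoin (cs : CoxeterSystem M W) (X : Set W) (g : W) : Prop :=
  IsUpperBound cs X g ∧ ∀ h, IsUpperBound cs X h → WeakLE cs g h

end WeakOrder

/-! ### Geometric representations -/

/-- The data of a geometric representation, in the real vector space `V`, of a Coxeter system with
Coxeter matrix `M` (an entry `0` of `M` stands for `∞`): a symmetric bilinear form on `V` and a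
simple system `(α_s)`. The simple roots are only assumed to be positively linearly independent, and
the form may be degenerate. -/
structure SimpleSystem {S : Type*} [Fintype S] (M : CoxeterMatrix S)
    (V : Type*) [AddCommGroup V] [Module ℝ V] where
  /-- The symmetric bilinear form `B`. -/
  form : LinearMap.BilinForm ℝ V
  form_symm : ∀ v w, form v w = form w v
  /-- The simple roots `α_s`. -/
  root : S → V
  pos_indep : ∀ a : S → ℝ, (∀ s, 0 ≤ a s) → ∑ s, a s • root s = 0 → ∀ s, a s = 0
  form_self : ∀ s, form (root s) (root s) = 1
  form_of_finite : ∀ s t, s ≠ t → M s t ≠ 0 →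
    form (root s) (root t) = -Real.cos (Real.pi / (M s t : ℝ))
  form_of_infinite : ∀ s t, M s t = 0 → form (root s) (root t) ≤ -1

namespace SimpleSystem

variable {S W V : Type*} [Fintype S] [Group W] [AddCommGroup V] [Module ℝ V]
  {M : CoxeterMatrix S} (D : SimpleSystem M V)

theorem two_form_self (s : S) : ((2 : ℝ) • D.form (D.root s)) (D.root s) = 2 := by
  simp [D.form_self]

/-- The reflection `v ↦ v - 2 B(α_s, v) α_s` (recall `B(α_s, α_s) = 1`). -/
def simpleReflection (s : S) : V ≃ₗ[ℝ] V :=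
  Module.reflection (D.two_form_self s)

theorem simpleReflection_apply (s : S) (v : V) :
    D.simpleReflection s v = v - (2 * D.form (D.root s) v) • D.root s := by
  simp [simpleReflection, Module.reflection_apply]

/-- The simple reflections satisfy the Coxeter relations. -/
theorem simpleReflection_isLiftable : M.IsLiftable D.simpleReflection := by
  intro s t
  by_cases hst : s = t
  · subst hst
    rw [M.diagonal, pow_one]
    ext v
    exact Module.involutive_reflection (D.two_form_self s) v
  by_cases hM : M s t = 0
  · rw [hM, pow_zero]
  have h1 := M.off_diagonal s t hst
  have hB := D.form_of_finite s t hst hM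
  have hB' : D.form (D.root t) (D.root s) = -Real.cos (Real.pi / (M s t : ℝ)) := by
    rw [D.form_symm, hB]
  generalize M s t = m at hM h1 hB hB'
  by_cases h2 : m = 2
  · subst h2
    have hc : Real.cos (Real.pi / ((2 : ℕ) : ℝ)) = 0 := by simp
    rw [hc, neg_zero] at hB hB'
    ext v
    simp only [pow_two, LinearEquiv.mul_apply, simpleReflection_apply, map_sub, map_smul, hB, hB',
      D.form_self, LinearEquiv.coe_one, id_eq]
    module
  have h3 : 3 ≤ m := by omega
  have hm0 : (m : ℝ) ≠ 0 := by exact_mod_cast hM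
  set θ : ℝ := 2 * (Real.pi / m) with hθ
  have hsin : Real.sin θ ≠ 0 := by
    have hm3 : (3 : ℝ) ≤ m := by exact_mod_cast h3
    apply ne_of_gt
    apply Real.sin_pos_of_pos_of_lt_pi
    · have := Real.pi_pos
      positivity
    · rw [hθ, ← mul_div_assoc, div_lt_iff₀ (by linarith)]
      nlinarith [Real.pi_pos]
  have hmθ : (m : ℝ) * θ = 2 * Real.pi := by rw [hθ]; field_simp
  have ht : 2 * Real.cos θ = ((2 : ℝ) • D.form (D.root s)) (D.root t) *
      ((2 : ℝ) • D.form (D.root t)) (D.root s) - 2 := by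
    simp only [LinearMap.smul_apply, hB, hB', smul_eq_mul, hθ, Real.cos_two_mul]
    ring
  have hS : ∀ k : ℤ, (Polynomial.Chebyshev.S ℝ k).eval (2 * Real.cos θ) * Real.sin θ =
      Real.sin ((k + 1) * θ) := fun k => Polynomial.Chebyshev.S_two_mul_real_cos θ k
  have key1 : (Polynomial.Chebyshev.S ℝ (((m : ℤ) - 2) / 2)).eval (2 * Real.cos θ) *
      ((Polynomial.Chebyshev.S ℝ (((m : ℤ) - 1) / 2)).eval (2 * Real.cos θ) +
        (Polynomial.Chebyshev.S ℝ (((m : ℤ) - 3) / 2)).eval (2 * Real.cos θ)) = 0 ∧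
      (Polynomial.Chebyshev.S ℝ (((m : ℤ) - 1) / 2)).eval (2 * Real.cos θ) *
      ((Polynomial.Chebyshev.S ℝ ((m : ℤ) / 2)).eval (2 * Real.cos θ) +
        (Polynomial.Chebyshev.S ℝ (((m : ℤ) - 2) / 2)).eval (2 * Real.cos θ)) = 0 := by
    obtain ⟨k, hk | hk⟩ := Nat.even_or_odd' m
    · have e1 : ((m : ℤ) - 2) / 2 = (k : ℤ) - 1 := by omega
      have e2 : ((m : ℤ) - 1) / 2 = (k : ℤ) - 1 := by omega
      have hz : (Polynomial.Chebyshev.S ℝ ((k : ℤ) - 1)).eval (2 * Real.cos θ) = 0 := by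
        have h := hS ((k : ℤ) - 1)
        have hkθ : (((k : ℤ) - 1 : ℤ) + 1 : ℝ) * θ = Real.pi := by
          rw [hk] at hmθ
          push_cast at hmθ ⊢
          linarith
        rw [hkθ, Real.sin_pi] at h
        exact (mul_eq_zero.mp h).resolve_right hsin
      rw [e1, e2, hz]
      simp
    · have e1 : ((m : ℤ) - 2) / 2 = (k : ℤ) - 1 := by omega
      have e2 : ((m : ℤ) - 1) / 2 = (k : ℤ) := by omega
      have e3 : ((m : ℤ) - 3) / 2 = (k : ℤ) - 1 := by omega
      have e4 : (m : ℤ) / 2 = (k : ℤ) := by omega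
      have hz : (Polynomial.Chebyshev.S ℝ (k : ℤ)).eval (2 * Real.cos θ) +
          (Polynomial.Chebyshev.S ℝ ((k : ℤ) - 1)).eval (2 * Real.cos θ) = 0 := by
        have h := hS (k : ℤ)
        have h' := hS ((k : ℤ) - 1)
        have hkθ : (((k : ℤ) : ℝ) + 1) * θ = 2 * Real.pi - (((k : ℤ) - 1 : ℤ) + 1 : ℝ) * θ := by
          rw [hk] at hmθ
          push_cast at hmθ ⊢
          linarith
        rw [hkθ, Real.sin_two_pi_sub] at h
        have : ((Polynomial.Chebyshev.S ℝ (k : ℤ)).eval (2 * Real.cos θ) +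
          (Polynomial.Chebyshev.S ℝ ((k : ℤ) - 1)).eval (2 * Real.cos θ)) * Real.sin θ = 0 := by
          rw [add_mul, h, h']
          ring
        exact (mul_eq_zero.mp this).resolve_right hsin
      rw [e1, e2, e3, e4, hz]
      simp
  ext v
  have := Module.reflection_mul_reflection_pow_apply (D.two_form_self s) (D.two_form_self t) m v
    (2 * Real.cos θ) ht
  rw [key1.1, key1.2] at this
  simpa [simpleReflection] using this

/-- The action of `W` on `V`: the simple reflection `s` acts as the reflection in `α_s`. -/
def action (cs : CoxeterSystem M W) : W →* (V ≃ₗ[ℝ] V) :=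
  cs.lift ⟨D.simpleReflection, D.simpleReflection_isLiftable⟩

theorem action_simple (cs : CoxeterSystem M W) (s : S) (v : V) :
    D.action cs (cs.simple s) v = v - (2 * D.form (D.root s) v) • D.root s := by
  rw [action, CoxeterSystem.lift_apply_simple, simpleReflection_apply]

/-- The root system `Φ = W(Δ)`. -/
def roots (cs : CoxeterSystem M W) : Set V :=
  {v | ∃ (w : W) (s : S), v = D.action cs w (D.root s)}

/-- The cone of all non-negative linear combinations of elements of `A`. -/
def cone (A : Set V) : Set V :=
  (PointedCone.hull ℝ A : Set V)

/-- `cone_Φ(A)`: the roots contained in the cone of `A`. -/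
def rootCone (cs : CoxeterSystem M W) (A : Set V) : Set V :=
  cone A ∩ D.roots cs

/-- The positive roots `Φ⁺ = cone(Δ) ∩ Φ`. -/
def posRoots (cs : CoxeterSystem M W) : Set V :=
  cone (Set.range D.root) ∩ D.roots cs

/-- The negative roots `Φ⁻ = -Φ⁺`. -/
def negRoots (cs : CoxeterSystem M W) : Set V :=
  {v | -v ∈ D.posRoots cs}

/-- The (left) inversion set `N(w) = Φ⁺ ∩ w(Φ⁻)`. -/
def inversions (cs : CoxeterSystem M W) (w : W) : Set V :=
  D.posRoots cs ∩ (D.action cs w '' D.negRoots cs)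

/-- `N(X)`, the union of the inversion sets `N(x)` for `x ∈ X`. -/
def inversionsOf (cs : CoxeterSystem M W) (X : Set W) : Set V :=
  ⋃ x ∈ X, D.inversions cs x

/-! ### Normalized roots and limit roots -/

/-- The affine hyperplane `V₁ = {v | φ v = 1}` is transverse to `Φ⁺`: it meets every ray spanned
by a positive root. Every affine hyperplane with this property that avoids the origin is of this
form for a unique linear form `φ`. -/
def IsTransverse (cs : CoxeterSystem M W) (φ : Module.Dual ℝ V) : Prop :=
  ∀ β ∈ D.posRoots cs, 0 < φ β

/-- The point `v̂` at which the line `ℝ v` meets `V₁ = {v | φ v = 1}` (meaningful if `φ v ≠ 0`). -/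
def normalize (φ : Module.Dual ℝ V) (v : V) : V :=
  (φ v)⁻¹ • v

/-- The set of normalized roots. -/
def normalizedRoots (cs : CoxeterSystem M W) (φ : Module.Dual ℝ V) : Set V :=
  normalize φ '' D.roots cs

/-- The set `E` of limit roots: the accumulation points of the set of normalized roots. -/
def limitRoots [TopologicalSpace V] (cs : CoxeterSystem M W) (φ : Module.Dual ℝ V) : Set V :=
  derivedSet (D.normalizedRoots cs φ)

/-- `conv(N̂(X))`, the convex hull of the normalized inversions of elements of `X`. -/
def convInversions (cs : CoxeterSystem M W) (φ : Module.Dual ℝ V) (X : Set W) : Set V :=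
  convexHull ℝ (normalize φ '' D.inversionsOf cs X)

/-- The imaginary convex body `conv(E)`. -/
def imaginaryConvexBody [TopologicalSpace V] (cs : CoxeterSystem M W) (φ : Module.Dual ℝ V) :
    Set V :=
  convexHull ℝ (D.limitRoots cs φ)

end SimpleSystem

/-- `A` and `B` are strictly separated by an affine hyperplane `{v | f v = c}`: they lie in opposite
open half-spaces bounded by it. -/
def StrictlySeparated {V : Type*} [AddCommGroup V] [Module ℝ V] (A B : Set V) : Prop :=
  ∃ (f : Module.Dual ℝ V) (c : ℝ), f ≠ 0 ∧ (∀ a ∈ A, f a < c) ∧ (∀ b ∈ B, c < f b)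

end CoxeterJoin

end

/-!
The proof rests on two facts about the linear form `φ` and its translates `φ ∘ g⁻¹`.

Since `φ` is positive on `Φ⁺`, the inversion set `N(g)` consists of the positive roots on which
`φ ∘ g⁻¹` is negative. So `φ ∘ g⁻¹` is negative on `N(g)` and, `N(g)` being finite, non-negative on
the limit roots. If `g` is an upper bound of `X`, then `N(X) ⊆ N(g)`, and a parallel translate of
the kernel of `φ ∘ g⁻¹` separates `N̂(X)` from `E` strictly.

Conversely, if a linear form `ψ` is positive on `E`, then by compactness it is negative on only
finitely many positive roots, and the set of these is an inversion set `N(g)`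
(`IsTransverse.exists_inversions_eq`): the simple reflection in a simple root of this set removes
that root and leaves a smaller set of the same kind. If `X` is finite and `conv(N̂(X))` is disjoint
from `conv(E)`, the Hahn–Banach theorem for these two compact convex sets gives such a `ψ` that is
negative on `N(X)`. Then `g` is an upper bound of `X`, because the weak order is containment of
inversion sets (`IsTransverse.weakLE_iff`).

A bounded set `X` has a join, and its inversion set is `cone_Φ(N(X))`, because there is an element
`g` with `N(X) ⊆ N(g) ⊆ cone(N(X))` (`IsTransverse.exists_inversions_subset_cone`): every inversion
set is closed under taking the roots in its cone, so `N(g)` is contained in the inversion set of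
any other upper bound. The element `g` is found by induction on the length of an upper bound, by
making all elements of `X` share a left descent and then removing it.

All of this depends on the theorem that `w(α_s)` is a positive root if `ℓ(ws) > ℓ(w)`
(`action_root_mem_cone`), whose only computation takes place in the plane of two simple roots. The
simple roots need not be linearly independent; it suffices that none of them lies in the cone of
the others (`coeff_eq_zero_of_smul_root_eq`).
-/

/-! ### Compact convex hulls -/

theorem IsCompact.convexJoin {E : Type*} [AddCommGroup E] [Module ℝ E] [TopologicalSpace E]
    [ContinuousAdd E] [ContinuousSMul ℝ E] {s t : Set E} (hs : IsCompact s) (ht : IsCompact t) :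
    IsCompact (convexJoin ℝ s t) := by
  have : _root_.convexJoin ℝ s t =
      (fun p : ℝ × E × E => (1 - p.1) • p.2.1 + p.1 • p.2.2) '' (Set.Icc 0 1 ×ˢ s ×ˢ t) := by
    ext x
    simp only [mem_convexJoin, segment_eq_image, Set.mem_image, Set.mem_prod, Prod.exists]
    constructor
    · rintro ⟨a, ha, b, hb, θ, hθ, rfl⟩
      exact ⟨θ, a, b, ⟨hθ, ha, hb⟩, rfl⟩
    · rintro ⟨θ, a, b, ⟨hθ, ha, hb⟩, rfl⟩
      exact ⟨a, ha, b, hb, θ, hθ, rfl⟩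
  rw [this]
  exact (isCompact_Icc.prod (hs.prod ht)).image (by fun_prop)

/-- By Carathéodory's theorem, the hull is a finite union of iterated joins of the set with
itself. -/
theorem IsCompact.convexHull {E : Type*} [NormedAddCommGroup E] [NormedSpace ℝ E]
    [FiniteDimensional ℝ E] {s : Set E} (hs : IsCompact s) : IsCompact (convexHull ℝ s) := by
  let K : ℕ → Set E := fun n => (_root_.convexJoin ℝ s)^[n] s
  have hK : ∀ n, K (n + 1) = _root_.convexJoin ℝ s (K n) := fun n =>
    Function.iterate_succ_apply' _ _ _
  have hcomp : ∀ n, IsCompact (K n) := by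
    intro n
    induction n with
    | zero => exact hs
    | succ n ih =>
      rw [hK]
      exact hs.convexJoin ih
  have hconv : ∀ n, K n ⊆ _root_.convexHull ℝ s := by
    intro n
    induction n with
    | zero => exact subset_convexHull ℝ s
    | succ n ih =>
      rw [hK]
      exact convexJoin_subset (subset_convexHull ℝ s) ih (convex_convexHull ℝ s)
  have hfin : ∀ t : Finset E, t.Nonempty → (t : Set E) ⊆ s →
      _root_.convexHull ℝ (t : Set E) ⊆ K (t.card - 1) := by
    intro t ht
    induction ht using Finset.Nonempty.cons_induction with
    | singleton a => simp [K]
    | cons a t ha ht ih =>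
      intro hts
      have hsub : (t : Set E) ⊆ s := fun x hx => hts (by simp [Finset.mem_coe.1 hx])
      have hcard : (Finset.cons a t ha).card - 1 = (t.card - 1) + 1 := by
        have := ht.card_pos
        rw [Finset.card_cons]
        omega
      rw [hcard, hK, Finset.coe_cons, convexHull_insert (by simpa using ht)]
      exact convexJoin_mono (by simpa using hts (by simp)) (ih hsub)
  have heq : _root_.convexHull ℝ s = ⋃ n ∈ Set.Iic (Module.finrank ℝ E), K n := by
    apply Set.Subset.antisymm
    · intro x hx
      rw [convexHull_eq_union] at hx
      simp only [Set.mem_iUnion] at hx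
      obtain ⟨t, hts, hind, hx⟩ := hx
      have hne : t.Nonempty := by
        rw [← Finset.coe_nonempty, ← convexHull_nonempty_iff (𝕜 := ℝ)]
        exact ⟨x, hx⟩
      have h1 := hind.card_le_finrank_succ
      have h2 := Submodule.finrank_le (vectorSpan ℝ (Set.range ((↑) : t → E)))
      rw [Fintype.card_coe] at h1
      exact Set.mem_biUnion (x := t.card - 1) (by simp only [Set.mem_Iic]; omega)
        (hfin t hne hts hx)
    · exact Set.iUnion₂_subset fun n _ => hconv n
  rw [heq]
  exact (Set.finite_Iic _).isCompact_biUnion fun n _ => hcomp n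

namespace CoxeterJoin

/-! ### Lengths and boundedness in the weak order -/

section WeakOrder

variable {S W : Type*} [Group W] {M : CoxeterMatrix S} {cs : CoxeterSystem M W}

theorem WeakLE.length_le {u v : W} (h : WeakLE cs u v) : cs.length u ≤ cs.length v := by
  obtain ⟨ω, ω', hω, hω', rfl, rfl, hp⟩ := h
  rw [hω.eq, hω'.eq]
  exact hp.length_le

theorem Bounded.finite [Finite S] {X : Set W} (h : Bounded cs X) : X.Finite := by
  obtain ⟨g, hg⟩ := h
  refine ((List.finite_length_le S (cs.length g)).image cs.wordProd).subset fun x hx => ?_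
  have hle := (hg x hx).length_le
  obtain ⟨ω, hω, rfl⟩ := cs.exists_isReduced x
  exact ⟨ω, by simpa [hω.eq] using hle, rfl⟩

end WeakOrder

namespace SimpleSystem

variable {S W V : Type*} [Fintype S] [Group W] [AddCommGroup V] [Module ℝ V]
  {M : CoxeterMatrix S} (D : SimpleSystem M V) (cs : CoxeterSystem M W)

/-! ### Cones -/

theorem subset_cone (A : Set V) : A ⊆ cone A := PointedCone.subset_hull

theorem cone_subset_cone {A C : Set V} (h : A ⊆ cone C) : cone A ⊆ cone C := by
  intro x hx
  exact (Submodule.span_le (p := PointedCone.hull ℝ C)).2 h hx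

theorem add_mem_cone {A : Set V} {x y : V} (hx : x ∈ cone A) (hy : y ∈ cone A) :
    x + y ∈ cone A :=
  (PointedCone.hull ℝ A).add_mem hx hy

theorem smul_mem_cone {A : Set V} {x : V} {c : ℝ} (hc : 0 ≤ c) (hx : x ∈ cone A) :
    c • x ∈ cone A :=
  (PointedCone.hull ℝ A).smul_mem hc hx

theorem cone_induction {A : Set V} {p : V → Prop} (mem : ∀ x ∈ A, p x) (zero : p 0)
    (add : ∀ x y, p x → p y → p (x + y)) (smul : ∀ (c : ℝ) x, 0 ≤ c → p x → p (c • x))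
    {x : V} (hx : x ∈ cone A) : p x := by
  change x ∈ Submodule.span {c : ℝ // 0 ≤ c} A at hx
  induction hx using Submodule.span_induction with
  | mem x h => exact mem x h
  | zero => exact zero
  | add x y _ _ h1 h2 => exact add x y h1 h2
  | smul c x _ h => exact smul c x c.2 h

theorem map_mem_cone_image {A : Set V} (f : V →ₗ[ℝ] V) {x : V} (hx : x ∈ cone A) :
    f x ∈ cone (f '' A) := by
  refine cone_induction (p := fun x => f x ∈ cone (f '' A)) ?_ ?_ ?_ ?_ hx
  · exact fun x hx => subset_cone _ ⟨x, hx, rfl⟩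
  · rw [map_zero]
    exact (PointedCone.hull ℝ _).zero_mem
  · intro x y hx hy
    rw [map_add]
    exact add_mem_cone hx hy
  · intro c x hc hx
    rw [map_smul]
    exact smul_mem_cone hc hx

/-- A linear form that is negative on a set is negative on its cone, except at the apex. -/
theorem eq_zero_or_neg_of_mem_cone {A : Set V} (f : Module.Dual ℝ V) (hA : ∀ a ∈ A, f a < 0)
    {x : V} (hx : x ∈ cone A) : x = 0 ∨ f x < 0 := by
  refine cone_induction (p := fun x => x = 0 ∨ f x < 0) (fun a ha => .inr (hA a ha)) (.inl rfl)
    ?_ ?_ hx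
  · rintro x y (rfl | hx) (rfl | hy)
    · simp
    · simp [hy]
    · simp [hx]
    · right
      rw [map_add]
      linarith
  · rintro c x hc (rfl | hx)
    · simp
    · rcases hc.eq_or_lt with rfl | hc
      · simp
      · right
        rw [map_smul, smul_eq_mul]
        exact mul_neg_of_pos_of_neg hc hx

theorem nonneg_of_mem_cone {A : Set V} (f : Module.Dual ℝ V) (hA : ∀ a ∈ A, 0 ≤ f a)
    {x : V} (hx : x ∈ cone A) : 0 ≤ f x := by
  refine cone_induction (p := fun x => 0 ≤ f x) hA (by simp) ?_ ?_ hx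
  · intro x y hx hy
    rw [map_add]
    linarith
  · intro c x hc hx
    rw [map_smul, smul_eq_mul]
    exact mul_nonneg hc hx

theorem root_mem_cone (s : S) : D.root s ∈ cone (Set.range D.root) :=
  subset_cone _ ⟨s, rfl⟩

theorem exists_coeff_of_mem_cone {v : V} (hv : v ∈ cone (Set.range D.root)) :
    ∃ a : S → ℝ, (∀ s, 0 ≤ a s) ∧ v = ∑ s, a s • D.root s := by
  classical
  refine cone_induction
    (p := fun v => ∃ a : S → ℝ, (∀ s, 0 ≤ a s) ∧ v = ∑ s, a s • D.root s) ?_ ?_ ?_ ?_ hv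
  · rintro _ ⟨s, rfl⟩
    refine ⟨Pi.single s 1, fun t => ?_, ?_⟩
    · by_cases h : t = s
      · subst h
        simp
      · simp [h]
    · simp [Pi.single_apply]
  · exact ⟨0, by simp, by simp⟩
  · rintro x y ⟨a, ha, rfl⟩ ⟨b, hb, rfl⟩
    exact ⟨a + b, fun s => add_nonneg (ha s) (hb s), by simp [add_smul, Finset.sum_add_distrib]⟩
  · rintro c x hc ⟨a, ha, rfl⟩
    exact ⟨c • a, fun s => mul_nonneg hc (ha s), by simp [Finset.smul_sum, smul_smul]⟩

theorem exists_coeff_of_mem_cone_pair {x y v : V} (hv : v ∈ cone {x, y}) :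
    ∃ a b : ℝ, 0 ≤ a ∧ 0 ≤ b ∧ v = a • x + b • y := by
  refine cone_induction
    (p := fun v => ∃ a b : ℝ, 0 ≤ a ∧ 0 ≤ b ∧ v = a • x + b • y) ?_ ?_ ?_ ?_ hv
  · rintro _ (rfl | rfl)
    · exact ⟨1, 0, by simp, by simp, by simp⟩
    · exact ⟨0, 1, by simp, by simp, by simp⟩
  · exact ⟨0, 0, le_rfl, le_rfl, by simp⟩
  · rintro _ _ ⟨a, b, ha, hb, rfl⟩ ⟨a', b', ha', hb', rfl⟩
    exact ⟨a + a', b + b', by positivity, by positivity, by module⟩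
  · rintro c _ hc ⟨a, b, ha, hb, rfl⟩
    exact ⟨c * a, c * b, by positivity, by positivity, by module⟩

/-! ### Simple roots -/

theorem form_root_nonpos {s t : S} (h : s ≠ t) : D.form (D.root s) (D.root t) ≤ 0 := by
  by_cases hM : M s t = 0
  · linarith [D.form_of_infinite s t hM]
  · rw [D.form_of_finite s t h hM, neg_nonpos]
    have h1 := M.off_diagonal s t h
    have h2 : (2 : ℝ) ≤ M s t := by
      have : 2 ≤ M s t := by omega
      exact_mod_cast this
    apply Real.cos_nonneg_of_neg_pi_div_two_le_of_le
    · have := Real.pi_pos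
      have : 0 ≤ Real.pi / (M s t : ℝ) := by positivity
      linarith
    · exact div_le_div_of_nonneg_left Real.pi_pos.le (by norm_num) h2

/-- No simple root lies in the cone of the others. This is the substitute for linear independence
of the simple roots. -/
theorem coeff_eq_zero_of_smul_root_eq {r : S} {x : ℝ} {c : S → ℝ} (hc : ∀ s, 0 ≤ c s)
    (h : x • D.root r = ∑ s, c s • D.root s) {t : S} (ht : t ≠ r) : c t = 0 := by
  classical
  rcases le_or_gt x (c r) with hx | hx
  · have := D.pos_indep (c - Pi.single r x) ?_ ?_ t
    · simpa [ht] using this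
    · intro s
      by_cases hs : s = r
      · subst hs
        simpa using hx
      · simpa [hs] using hc s
    · simp [sub_smul, Finset.sum_sub_distrib, ← h, Pi.single_apply]
  · exfalso
    -- Pairing with `α_r` gives `x ≤ c r`, since distinct simple roots pair non-positively.
    have h1 := congrArg (D.form (D.root r)) h
    rw [map_smul, D.form_self, map_sum] at h1
    simp only [map_smul, smul_eq_mul, mul_one] at h1
    have h2 : ∑ s, c s * D.form (D.root r) (D.root s) ≤ ∑ s, Pi.single r (c r) s := by
      apply Finset.sum_le_sum
      intro s _
      by_cases hs : s = r
      · subst hs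
        simp [D.form_self]
      · simpa [hs] using
          mul_nonpos_of_nonneg_of_nonpos (hc s) (D.form_root_nonpos (Ne.symm hs))
    rw [Finset.sum_pi_single'] at h2
    simp at h2
    linarith

theorem coeff_nonneg_of_mem_cone {r s : S} (hrs : r ≠ s) {a b : ℝ}
    (h : a • D.root r + b • D.root s ∈ cone (Set.range D.root)) : 0 ≤ b := by
  classical
  by_contra! hb
  obtain ⟨c, hc, hsum⟩ := D.exists_coeff_of_mem_cone h
  have := D.coeff_eq_zero_of_smul_root_eq (r := r) (x := a) (c := c - Pi.single s b) ?_ ?_ hrs.symm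
  · simp at this
    linarith [hc s]
  · intro t
    by_cases ht : t = s
    · subst ht
      simp
      linarith [hc t]
    · simpa [ht] using hc t
  · simp [sub_smul, Finset.sum_sub_distrib, ← hsum, Pi.single_apply]

/-- The plane spanned by two simple roots meets the cone of all simple roots only in the cone of
these two. -/
theorem mem_cone_pair {r s : S} (hrs : r ≠ s) {a b : ℝ}
    (h : a • D.root r + b • D.root s ∈ cone (Set.range D.root)) :
    a • D.root r + b • D.root s ∈ cone {D.root r, D.root s} := by
  have hb := D.coeff_nonneg_of_mem_cone hrs h
  have ha := D.coeff_nonneg_of_mem_cone hrs.symm (add_comm (a • D.root r) _ ▸ h)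
  exact add_mem_cone (smul_mem_cone ha (subset_cone _ (by simp)))
    (smul_mem_cone hb (subset_cone _ (by simp)))

/-! ### The action on roots -/

theorem action_mul_apply (u w : W) (v : V) :
    D.action cs (u * w) v = D.action cs u (D.action cs w v) := by
  rw [map_mul, LinearEquiv.mul_apply]

@[simp]
theorem action_one_apply (v : V) : D.action cs 1 v = v := by
  simp

@[simp]
theorem action_inv_action (w : W) (v : V) : D.action cs w⁻¹ (D.action cs w v) = v := by
  rw [← action_mul_apply, inv_mul_cancel, action_one_apply]

@[simp]
theorem action_action_inv (w : W) (v : V) : D.action cs w (D.action cs w⁻¹ v) = v := by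
  rw [← action_mul_apply, mul_inv_cancel, action_one_apply]

@[simp]
theorem action_simple_action_simple (s : S) (v : V) :
    D.action cs (cs.simple s) (D.action cs (cs.simple s) v) = v := by
  rw [← action_mul_apply, cs.simple_mul_simple_self, action_one_apply]

@[simp]
theorem action_simple_root (s : S) : D.action cs (cs.simple s) (D.root s) = -D.root s := by
  rw [action_simple, D.form_self]
  module

theorem form_action (w : W) (v v' : V) :
    D.form (D.action cs w v) (D.action cs w v') = D.form v v' := by
  induction w using cs.simple_induction_left generalizing v v' with
  | one => simp
  | mul_simple_left w s ih =>
    rw [action_mul_apply, action_mul_apply, ← ih v v', action_simple, action_simple]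
    simp only [map_sub, map_smul, LinearMap.sub_apply, LinearMap.smul_apply, smul_eq_mul,
      D.form_self]
    rw [D.form_symm _ (D.root s)]
    ring

theorem root_mem_roots (s : S) : D.root s ∈ D.roots cs := ⟨1, s, by simp⟩

theorem action_mem_roots (w : W) {β : V} (hβ : β ∈ D.roots cs) : D.action cs w β ∈ D.roots cs := by
  obtain ⟨u, s, rfl⟩ := hβ
  exact ⟨w * u, s, by rw [action_mul_apply]⟩

theorem neg_mem_roots {β : V} (hβ : β ∈ D.roots cs) : -β ∈ D.roots cs := by
  obtain ⟨u, s, rfl⟩ := hβ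
  exact ⟨u * cs.simple s, s, by rw [action_mul_apply, action_simple_root, map_neg]⟩

theorem form_self_of_mem_roots {β : V} (hβ : β ∈ D.roots cs) : D.form β β = 1 := by
  obtain ⟨u, s, rfl⟩ := hβ
  rw [form_action, D.form_self]

theorem ne_zero_of_mem_roots {β : V} (hβ : β ∈ D.roots cs) : β ≠ 0 := by
  rintro rfl
  simpa using D.form_self_of_mem_roots cs hβ

/-! ### Length and positivity -/

open Polynomial in
theorem eval_chebyshev_nonneg {s t : S} (hst : s ≠ t) {k : ℕ} (hk : M s t = 0 ∨ k < M s t) :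
    0 ≤ (Chebyshev.S ℝ k).eval (-2 * D.form (D.root s) (D.root t)) := by
  by_cases hM : M s t = 0
  · have hc := D.form_of_infinite s t hM
    generalize D.form (D.root s) (D.root t) = b at hc
    have key : ∀ k : ℕ, 0 ≤ (Chebyshev.S ℝ (k : ℤ)).eval (-2 * b) ∧
        (Chebyshev.S ℝ ((k : ℤ) - 1)).eval (-2 * b) ≤ (Chebyshev.S ℝ (k : ℤ)).eval (-2 * b) := by
      intro k
      induction k with
      | zero => simp
      | succ k ih =>
        have h := congrArg (Polynomial.eval (-2 * b)) (Chebyshev.S_add_two ℝ ((k : ℤ) - 1))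
        rw [show (k : ℤ) - 1 + 2 = k + 1 by ring, sub_add_cancel] at h
        rw [eval_sub, eval_mul, eval_X] at h
        push_cast
        rw [add_sub_cancel_right, h]
        constructor <;> nlinarith
    exact (key k).1
  · replace hk := hk.resolve_left hM
    have hoff := M.off_diagonal s t hst
    rw [D.form_of_finite s t hst hM]
    have hm : (2 : ℝ) ≤ M s t := by
      have : 2 ≤ M s t := by omega
      exact_mod_cast this
    generalize hmm : (M s t : ℝ) = m at hm
    have hkm : (k : ℝ) + 1 ≤ m := by
      rw [← hmm]
      exact_mod_cast hk
    have hπ := Real.pi_pos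
    have hsin : 0 < Real.sin (Real.pi / m) :=
      Real.sin_pos_of_pos_of_lt_pi (by positivity) (div_lt_self hπ (by linarith))
    have h := Chebyshev.S_two_mul_real_cos (Real.pi / m) k
    have h0 : 0 ≤ Real.sin ((((k : ℤ) : ℝ) + 1) * (Real.pi / m)) := by
      apply Real.sin_nonneg_of_nonneg_of_le_pi
      · push_cast
        positivity
      · rw [← mul_div_assoc, div_le_iff₀ (by linarith)]
        push_cast
        nlinarith
    rw [← h] at h0
    have := nonneg_of_mul_nonneg_left h0 hsin
    rwa [show -2 * -Real.cos (Real.pi / m) = 2 * Real.cos (Real.pi / m) by ring]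

open Polynomial in
/-- In the plane of two simple roots the coefficients are values of rescaled Chebyshev polynomials
of the second kind. -/
theorem action_alternatingWord (s t : S) (k : ℕ) :
    D.action cs (cs.wordProd (CoxeterSystem.alternatingWord s t k)) (D.root s) =
      (Chebyshev.S ℝ k).eval (-2 * D.form (D.root s) (D.root t)) •
          D.root (if Even k then s else t) +
        (Chebyshev.S ℝ ((k : ℤ) - 1)).eval (-2 * D.form (D.root s) (D.root t)) •
          D.root (if Even k then t else s) := by
  induction k with
  | zero => simp [CoxeterSystem.alternatingWord]
  | succ k ih =>
    have h := congrArg (Polynomial.eval (-2 * D.form (D.root s) (D.root t)))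
      (Chebyshev.S_add_two ℝ ((k : ℤ) - 1))
    rw [show (k : ℤ) - 1 + 2 = k + 1 by ring, sub_add_cancel, eval_sub, eval_mul, eval_X] at h
    rw [CoxeterSystem.alternatingWord_succ', cs.wordProd_cons, action_mul_apply, ih]
    push_cast
    rw [add_sub_cancel_right, h]
    by_cases hk : Even k
    · have hk' : ¬ Even (k + 1) := by simpa [Nat.even_add_one] using hk
      simp only [hk, hk', if_true, if_false, action_simple, map_add, map_smul, D.form_self,
        D.form_symm (D.root t) (D.root s)]
      module
    · have hk' : Even (k + 1) := by simpa [Nat.even_add_one] using hk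
      simp only [hk, hk', if_true, if_false, action_simple, map_add, map_smul, D.form_self]
      module

theorem action_alternatingWord_mem_cone {s t : S} (hst : s ≠ t) {k : ℕ}
    (hk : M s t = 0 ∨ k < M s t) :
    D.action cs (cs.wordProd (CoxeterSystem.alternatingWord s t k)) (D.root s) ∈
      cone {D.root s, D.root t} := by
  rw [action_alternatingWord]
  have h0 : 0 ≤ (Polynomial.Chebyshev.S ℝ ((k : ℤ) - 1)).eval
      (-2 * D.form (D.root s) (D.root t)) := by
    cases k with
    | zero => simp
    | succ k =>
      push_cast
      rw [add_sub_cancel_right]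
      exact D.eval_chebyshev_nonneg hst (hk.imp_right fun h => by omega)
  refine add_mem_cone (smul_mem_cone (D.eval_chebyshev_nonneg hst hk) (subset_cone _ ?_))
    (smul_mem_cone h0 (subset_cone _ ?_)) <;> split_ifs <;> simp

/-- If `ℓ(ws) > ℓ(w)`, then `w(α_s)` is positive. To see this, split off from the right of `w` the
longest possible alternating word in `s` and a right descent `t` of `w`. -/
theorem action_root_mem_cone {w : W} {s : S} (h : ¬ cs.IsRightDescent w s) :
    D.action cs w (D.root s) ∈ cone (Set.range D.root) := by
  classical
  induction hn : cs.length w using Nat.strong_induction_on generalizing w s with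
  | _ n ih =>
  subst hn
  by_cases hw : w = 1
  · subst hw
    simpa using D.root_mem_cone s
  obtain ⟨t, ht⟩ := cs.exists_rightDescent_of_ne_one hw
  have hst : s ≠ t := by
    rintro rfl
    exact h ht
  rw [cs.not_isRightDescent_iff] at h
  rw [cs.isRightDescent_iff] at ht
  let P : ℕ → Prop := fun k => ∃ v,
    w = v * cs.wordProd (CoxeterSystem.alternatingWord s t k) ∧ cs.length w = cs.length v + k
  have hP1 : P 1 := ⟨w * cs.simple t, by simp [CoxeterSystem.alternatingWord], by omega⟩
  have hw1 : 1 ≤ cs.length w := by omega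
  let k := Nat.findGreatest P (cs.length w)
  obtain ⟨v, hwv, hlen⟩ : P k := Nat.findGreatest_spec hw1 hP1
  have hk1 : 1 ≤ k := Nat.le_findGreatest hw1 hP1
  have hkP : ¬ P (k + 1) := fun hcon => by
    have h2 : k + 1 ≤ cs.length w := by
      obtain ⟨v', -, h3⟩ := hcon
      omega
    have := Nat.le_findGreatest h2 hcon
    omega
  clear_value k
  have hsucc := CoxeterSystem.alternatingWord_succ' s t
  -- `v` has neither `s` nor `t` as a right descent: one would make the alternating word longer,
  -- the other would make `w` shorter.
  have hv1 : ¬ cs.IsRightDescent v (if Even k then t else s) := by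
    intro hd
    rw [cs.isRightDescent_iff] at hd
    refine hkP ⟨v * cs.simple (if Even k then t else s), ?_, by omega⟩
    rw [hsucc, cs.wordProd_cons, mul_assoc, cs.simple_mul_simple_cancel_left]
    exact hwv
  have hv2 : ¬ cs.IsRightDescent v (if Even k then s else t) := by
    intro hd
    rw [cs.isRightDescent_iff] at hd
    obtain ⟨j, rfl⟩ : ∃ j, k = j + 1 := ⟨k - 1, by omega⟩
    have hpar : (if Even (j + 1) then s else t) = if Even j then t else s := by
      by_cases hj : Even j <;> simp [hj, Nat.even_add_one]
    rw [hpar] at hd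
    rw [hsucc, cs.wordProd_cons, ← mul_assoc] at hwv
    have h1 := cs.length_mul_le (v * cs.simple (if Even j then t else s))
      (cs.wordProd (CoxeterSystem.alternatingWord s t j))
    have h2 := cs.length_wordProd_le (CoxeterSystem.alternatingWord s t j)
    rw [CoxeterSystem.length_alternatingWord] at h2
    rw [← hwv] at h1
    omega
  have hvs : ¬ cs.IsRightDescent v s ∧ ¬ cs.IsRightDescent v t := by
    by_cases he : Even k
    · exact ⟨by simpa [he] using hv2, by simpa [he] using hv1⟩
    · exact ⟨by simpa [he] using hv1, by simpa [he] using hv2⟩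
  -- Otherwise the alternating word, prolonged by `s`, is not reduced and `ℓ(ws) ≤ ℓ(w)`.
  have hkm : M s t = 0 ∨ k < M s t := by
    by_contra! hcon
    have hM : M t s ≠ 0 := by
      rw [M.symmetric]
      exact hcon.1
    have hred := cs.not_isReduced_alternatingWord t s (m := k + 1) hM (by
      rw [M.symmetric]
      omega)
    have h1 := cs.length_wordProd_le (CoxeterSystem.alternatingWord t s (k + 1))
    rw [CoxeterSystem.IsReduced] at hred
    rw [CoxeterSystem.length_alternatingWord] at h1 hred
    have h2 : w * cs.simple s =
        v * cs.wordProd (CoxeterSystem.alternatingWord t s (k + 1)) := by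
      rw [CoxeterSystem.alternatingWord_succ, cs.wordProd_concat, ← mul_assoc, ← hwv]
    have h3 := cs.length_mul_le v (cs.wordProd (CoxeterSystem.alternatingWord t s (k + 1)))
    rw [← h2] at h3
    omega
  obtain ⟨a, b, ha, hb, hab⟩ := exists_coeff_of_mem_cone_pair
    (D.action_alternatingWord_mem_cone cs hst hkm)
  rw [hwv, action_mul_apply, hab, map_add, map_smul, map_smul]
  exact add_mem_cone (smul_mem_cone ha (ih _ (by omega) hvs.1 rfl))
    (smul_mem_cone hb (ih _ (by omega) hvs.2 rfl))

theorem neg_action_root_mem_cone {w : W} {s : S} (h : cs.IsRightDescent w s) :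
    -D.action cs w (D.root s) ∈ cone (Set.range D.root) := by
  have := D.action_root_mem_cone cs (cs.isRightDescent_iff_not_isRightDescent_mul.1 h)
  rwa [action_mul_apply, action_simple_root, map_neg] at this

/-- Every root is positive or negative. -/
theorem mem_posRoots_or_neg_mem {β : V} (hβ : β ∈ D.roots cs) :
    β ∈ D.posRoots cs ∨ -β ∈ D.posRoots cs := by
  obtain ⟨w, s, rfl⟩ := id hβ
  by_cases h : cs.IsRightDescent w s
  · exact .inr ⟨D.neg_action_root_mem_cone cs h, D.neg_mem_roots cs hβ⟩
  · exact .inl ⟨D.action_root_mem_cone cs h, hβ⟩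

theorem root_mem_posRoots (s : S) : D.root s ∈ D.posRoots cs :=
  ⟨D.root_mem_cone s, D.root_mem_roots cs s⟩

/-- A simple reflection permutes the positive roots other than its own simple root. -/
theorem action_simple_mem_posRoots {β : V} {s : S} (hβ : β ∈ D.posRoots cs) (hne : β ≠ D.root s) :
    D.action cs (cs.simple s) β ∈ D.posRoots cs := by
  refine (D.mem_posRoots_or_neg_mem cs (D.action_mem_roots cs _ hβ.2)).resolve_right fun hneg => ?_
  obtain ⟨a, ha, hasum⟩ := D.exists_coeff_of_mem_cone hβ.1
  obtain ⟨b, hb, hbsum⟩ := D.exists_coeff_of_mem_cone hneg.1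
  have hzero : ∀ t ≠ s, a t = 0 := by
    intro t ht
    have := D.coeff_eq_zero_of_smul_root_eq (r := s) (x := 2 * D.form (D.root s) β) (c := a + b)
      (fun t => add_nonneg (ha t) (hb t)) ?_ ht
    · simp only [Pi.add_apply] at this
      linarith [ha t, hb t]
    · simp only [Pi.add_apply, add_smul, Finset.sum_add_distrib]
      rw [← hasum, ← hbsum, action_simple]
      module
  have hβs : β = a s • D.root s := by
    rw [hasum]
    exact Finset.sum_eq_single s (fun t _ ht => by rw [hzero t ht, zero_smul]) (by simp)
  have h1 := D.form_self_of_mem_roots cs hβ.2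
  rw [hβs] at h1
  simp only [map_smul, LinearMap.smul_apply, smul_eq_mul, D.form_self] at h1
  have : a s = 1 := by nlinarith [ha s]
  rw [this, one_smul] at hβs
  exact hne hβs

/-! ### Inversion sets -/

variable {D cs} {φ : Module.Dual ℝ V}

theorem IsTransverse.mem_posRoots_iff (hφ : D.IsTransverse cs φ) {β : V} :
    β ∈ D.posRoots cs ↔ β ∈ D.roots cs ∧ 0 < φ β := by
  refine ⟨fun h => ⟨h.2, hφ β h⟩, fun ⟨h, hpos⟩ => ?_⟩
  refine (D.mem_posRoots_or_neg_mem cs h).resolve_right fun hneg => ?_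
  have := hφ _ hneg
  rw [map_neg] at this
  linarith

theorem IsTransverse.neg_mem_posRoots_iff (hφ : D.IsTransverse cs φ) {β : V}
    (hβ : β ∈ D.roots cs) : -β ∈ D.posRoots cs ↔ φ β < 0 := by
  rw [hφ.mem_posRoots_iff, map_neg, neg_pos]
  exact ⟨fun h => h.2, fun h => ⟨D.neg_mem_roots cs hβ, h⟩⟩

/-- `N(w)` is cut out of `Φ⁺` by the linear form `φ ∘ w⁻¹`. -/
theorem IsTransverse.mem_inversions_iff (hφ : D.IsTransverse cs φ) {w : W} {β : V} :
    β ∈ D.inversions cs w ↔ β ∈ D.posRoots cs ∧ φ (D.action cs w⁻¹ β) < 0 := by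
  constructor
  · rintro ⟨hβ, γ, hγ, rfl⟩
    refine ⟨hβ, ?_⟩
    rw [action_inv_action]
    have := hφ _ hγ
    rw [map_neg] at this
    linarith
  · rintro ⟨hβ, hneg⟩
    refine ⟨hβ, D.action cs w⁻¹ β, ?_, by simp⟩
    exact (hφ.neg_mem_posRoots_iff (D.action_mem_roots cs _ hβ.2)).2 hneg

theorem IsTransverse.inversions_one (hφ : D.IsTransverse cs φ) : D.inversions cs 1 = ∅ := by
  ext β
  rw [hφ.mem_inversions_iff]
  simp only [inv_one, action_one_apply, Set.mem_empty_iff_false, iff_false, not_and, not_lt]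
  exact fun h => (hφ β h).le

theorem IsTransverse.root_mem_inversions_iff (hφ : D.IsTransverse cs φ) {w : W} {s : S} :
    D.root s ∈ D.inversions cs w ↔ cs.IsLeftDescent w s := by
  rw [hφ.mem_inversions_iff, ← cs.isRightDescent_inv_iff]
  constructor
  · intro h
    by_contra hd
    have := hφ _ ⟨D.action_root_mem_cone cs hd, D.action_mem_roots cs _ (D.root_mem_roots cs s)⟩
    linarith [h.2]
  · intro hd
    refine ⟨D.root_mem_posRoots cs s, ?_⟩
    rw [← hφ.neg_mem_posRoots_iff (D.action_mem_roots cs _ (D.root_mem_roots cs s))]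
    exact ⟨D.neg_action_root_mem_cone cs hd,
      D.neg_mem_roots cs (D.action_mem_roots cs _ (D.root_mem_roots cs s))⟩

theorem IsTransverse.mem_inversions_simple_mul_iff (hφ : D.IsTransverse cs φ) {w : W} {s : S}
    {β : V} (hβ : β ∈ D.posRoots cs) (hne : β ≠ D.root s) :
    β ∈ D.inversions cs (cs.simple s * w) ↔ D.action cs (cs.simple s) β ∈ D.inversions cs w := by
  rw [hφ.mem_inversions_iff, hφ.mem_inversions_iff, mul_inv_rev, cs.inv_simple, action_mul_apply]
  simp [hβ, D.action_simple_mem_posRoots cs hβ hne]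

theorem IsTransverse.inversions_finite (hφ : D.IsTransverse cs φ) (w : W) :
    (D.inversions cs w).Finite := by
  induction w using cs.simple_induction_left with
  | one => simp [hφ.inversions_one]
  | mul_simple_left w s ih =>
    refine ((ih.image (D.action cs (cs.simple s))).insert (D.root s)).subset fun β hβ => ?_
    by_cases hne : β = D.root s
    · exact .inl hne
    · exact .inr ⟨_, (hφ.mem_inversions_simple_mul_iff hβ.1 hne).1 hβ, by simp⟩

/-- Inversion sets are closed under taking roots in the cone. -/
theorem IsTransverse.mem_inversions_of_mem_cone (hφ : D.IsTransverse cs φ) {w : W} {A : Set V}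
    (hA : A ⊆ D.inversions cs w) {β : V} (hβ : β ∈ D.roots cs) (hc : β ∈ cone A) :
    β ∈ D.inversions cs w := by
  have h0 := D.ne_zero_of_mem_roots cs hβ
  have hA' : ∀ a ∈ A, a ∈ D.posRoots cs ∧ φ (D.action cs w⁻¹ a) < 0 :=
    fun a ha => hφ.mem_inversions_iff.1 (hA ha)
  refine hφ.mem_inversions_iff.2 ⟨?_, ?_⟩
  · exact ⟨cone_subset_cone (fun a ha => (hA' a ha).1.1) hc, hβ⟩
  · exact (eq_zero_or_neg_of_mem_cone (φ ∘ₗ (D.action cs w⁻¹).toLinearMap)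
      (fun a ha => (hA' a ha).2) hc).resolve_left h0

theorem IsTransverse.inversions_simple_mul_subset (hφ : D.IsTransverse cs φ) {u v : W} {s : S}
    (hu : D.root s ∈ D.inversions cs u) (huv : D.inversions cs u ⊆ D.inversions cs v) :
    D.inversions cs (cs.simple s * u) ⊆ D.inversions cs (cs.simple s * v) := by
  intro β hβ
  have hne : β ≠ D.root s := by
    rintro rfl
    rw [hφ.root_mem_inversions_iff] at hβ hu
    exact cs.isLeftDescent_iff_not_isLeftDescent_mul.1 hu hβ
  rw [hφ.mem_inversions_simple_mul_iff hβ.1 hne]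
  exact huv ((hφ.mem_inversions_simple_mul_iff hβ.1 hne).1 hβ)

/-! ### The weak order -/

theorem IsTransverse.weakLE_of_inversions_subset (hφ : D.IsTransverse cs φ) {u v : W}
    (h : D.inversions cs u ⊆ D.inversions cs v) : WeakLE cs u v := by
  induction hn : cs.length u using Nat.strong_induction_on generalizing u v with
  | _ n ih =>
  subst hn
  by_cases hu : u = 1
  · subst hu
    obtain ⟨ω, hω, rfl⟩ := cs.exists_isReduced v
    exact ⟨[], ω, by simp [CoxeterSystem.IsReduced], hω, by simp, rfl, List.nil_prefix⟩
  obtain ⟨s, hs⟩ := cs.exists_leftDescent_of_ne_one hu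
  have hmem := hφ.root_mem_inversions_iff.2 hs
  have hv := hφ.root_mem_inversions_iff.1 (h hmem)
  rw [cs.isLeftDescent_iff] at hs hv
  obtain ⟨ω, ω', hω, hω', h1, h2, hp⟩ :=
    ih (cs.length (cs.simple s * u)) (by omega) (hφ.inversions_simple_mul_subset hmem h) rfl
  have e1 : cs.wordProd (s :: ω) = u := by rw [cs.wordProd_cons, h1]; simp
  have e2 : cs.wordProd (s :: ω') = v := by rw [cs.wordProd_cons, h2]; simp
  refine ⟨s :: ω, s :: ω', ?_, ?_, e1, e2, List.cons_prefix_cons.2 ⟨rfl, hp⟩⟩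
  · rw [CoxeterSystem.IsReduced, e1, List.length_cons, ← hω.eq, h1, hs]
  · rw [CoxeterSystem.IsReduced, e2, List.length_cons, ← hω'.eq, h2, hv]

theorem IsTransverse.inversions_wordProd_subset (hφ : D.IsTransverse cs φ) {ω τ : List S}
    (h : cs.IsReduced (ω ++ τ)) :
    D.inversions cs (cs.wordProd ω) ⊆ D.inversions cs (cs.wordProd (ω ++ τ)) := by
  induction ω with
  | nil => simp [hφ.inversions_one]
  | cons s ω ih =>
    rw [List.cons_append] at h
    have h' : cs.IsReduced (ω ++ τ) := by simpa using h.drop 1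
    intro β hβ
    rw [List.cons_append]
    by_cases hne : β = D.root s
    · subst hne
      rw [hφ.root_mem_inversions_iff, cs.isLeftDescent_iff, h.eq, cs.wordProd_cons,
        cs.simple_mul_simple_cancel_left, h'.eq, List.length_cons]
    · rw [cs.wordProd_cons] at hβ ⊢
      rw [hφ.mem_inversions_simple_mul_iff hβ.1 hne]
      exact ih h' ((hφ.mem_inversions_simple_mul_iff hβ.1 hne).1 hβ)

/-- The weak order is containment of inversion sets. -/
theorem IsTransverse.weakLE_iff (hφ : D.IsTransverse cs φ) {u v : W} :
    WeakLE cs u v ↔ D.inversions cs u ⊆ D.inversions cs v := by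
  refine ⟨?_, hφ.weakLE_of_inversions_subset⟩
  rintro ⟨ω, _, -, hω', rfl, rfl, τ, rfl⟩
  exact hφ.inversions_wordProd_subset hω'

theorem IsTransverse.isUpperBound_iff (hφ : D.IsTransverse cs φ) {X : Set W} {g : W} :
    IsUpperBound cs X g ↔ D.inversionsOf cs X ⊆ D.inversions cs g := by
  simp only [IsUpperBound, hφ.weakLE_iff, inversionsOf, Set.iUnion_subset_iff]

theorem IsTransverse.inversionsOf_finite (hφ : D.IsTransverse cs φ) {X : Set W} (hX : X.Finite) :
    (D.inversionsOf cs X).Finite :=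
  hX.biUnion fun x _ => hφ.inversions_finite x

/-! ### Half-spaces and inversion sets -/

/-- A finite set of positive roots cut out by an open linear half-space is an inversion set: if it
is non-empty, it contains a simple root, and the corresponding simple reflection takes the set
without that root to a smaller set of the same kind. -/
theorem IsTransverse.exists_inversions_eq (hφ : D.IsTransverse cs φ) (ψ : Module.Dual ℝ V)
    (hfin : {β ∈ D.posRoots cs | ψ β < 0}.Finite) :
    ∃ g, D.inversions cs g = {β ∈ D.posRoots cs | ψ β < 0} := by
  induction hn : {β ∈ D.posRoots cs | ψ β < 0}.ncard using Nat.strong_induction_on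
    generalizing ψ with
  | _ n ih =>
  subst hn
  by_cases hex : ∃ s, ψ (D.root s) < 0
  · obtain ⟨s, hs⟩ := hex
    set ψ' : Module.Dual ℝ V := ψ ∘ₗ (D.action cs (cs.simple s)).toLinearMap with hψ'
    have hne : ∀ β, ψ' β < 0 → β ≠ D.root s := by
      rintro _ h rfl
      simp [hψ'] at h
      linarith
    have hsub : D.action cs (cs.simple s) '' {β ∈ D.posRoots cs | ψ' β < 0} ⊆
        {β ∈ D.posRoots cs | ψ β < 0} := by
      rintro _ ⟨β, ⟨hβ, hneg⟩, rfl⟩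
      exact ⟨D.action_simple_mem_posRoots cs hβ (hne β hneg), hneg⟩
    have hinj := (D.action cs (cs.simple s)).injective
    have hlt : {β ∈ D.posRoots cs | ψ' β < 0}.ncard < {β ∈ D.posRoots cs | ψ β < 0}.ncard := by
      rw [← Set.ncard_image_of_injective _ hinj]
      refine Set.ncard_lt_ncard ⟨hsub, fun hcon => ?_⟩ hfin
      obtain ⟨γ, ⟨hγ, -⟩, hγs⟩ := hcon ⟨D.root_mem_posRoots cs s, hs⟩
      have hγ' : γ = -D.root s := by
        rw [← D.action_simple_root cs s, ← hγs, action_simple_action_simple]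
      have h1 := hφ γ hγ
      have h2 := hφ _ (D.root_mem_posRoots cs s)
      rw [hγ', map_neg] at h1
      linarith
    obtain ⟨g, hg⟩ := ih _ hlt ψ' (Set.Finite.of_finite_image (hfin.subset hsub) hinj.injOn) rfl
    refine ⟨cs.simple s * g, ?_⟩
    ext β
    by_cases hβs : β = D.root s
    · subst hβs
      have : D.root s ∉ D.inversions cs g := by
        rw [hg]
        exact fun h => hne _ h.2 rfl
      rw [hφ.root_mem_inversions_iff] at this ⊢
      have hd : cs.IsLeftDescent (cs.simple s * g) s := by
        rw [cs.isLeftDescent_iff_not_isLeftDescent_mul]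
        simpa using this
      exact ⟨fun _ => ⟨D.root_mem_posRoots cs s, hs⟩, fun _ => hd⟩
    · by_cases hβ : β ∈ D.posRoots cs
      · rw [hφ.mem_inversions_simple_mul_iff hβ hβs, hg]
        simp [hψ', hβ, D.action_simple_mem_posRoots cs hβ hβs]
      · exact ⟨fun h => absurd h.1 hβ, fun h => absurd h.1 hβ⟩
  · push Not at hex
    refine ⟨1, ?_⟩
    rw [hφ.inversions_one, eq_comm, Set.eq_empty_iff_forall_notMem]
    rintro β ⟨hβ, hneg⟩
    have := nonneg_of_mem_cone ψ (by rintro _ ⟨s, rfl⟩; exact hex s) hβ.1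
    linarith

/-! ### Joins -/

/-- If an inversion set contains two simple roots, then the parabolic subgroup of rank two
generated by the corresponding reflections is finite; the element found here is its longest one. -/
theorem IsTransverse.exists_inversions_subset_cone_pair (hφ : D.IsTransverse cs φ) {h : W}
    {r s : S} (hrs : r ≠ s) (hr : D.root r ∈ D.inversions cs h)
    (hs : D.root s ∈ D.inversions cs h) :
    ∃ w, D.root r ∈ D.inversions cs w ∧ D.root s ∈ D.inversions cs w ∧
      D.inversions cs w ⊆ cone {D.root r, D.root s} := by
  let Q : Set W := {w | D.inversions cs w ⊆ cone {D.root r, D.root s}}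
  have hQlen : ∀ w ∈ Q, cs.length w ≤ cs.length h := by
    intro w hw
    refine (hφ.weakLE_of_inversions_subset fun β hβ => ?_).length_le
    refine hφ.mem_inversions_of_mem_cone ?_ hβ.1.2 (hw hβ)
    rintro _ (rfl | rfl)
    · exact hr
    · exact hs
  have hQmul : ∀ w ∈ Q, ∀ t, t = r ∨ t = s → cs.simple t * w ∈ Q := by
    intro w hw t ht β hβ
    by_cases hβt : β = D.root t
    · subst hβt
      exact subset_cone _ (by rcases ht with rfl | rfl <;> simp)
    · have h1 := (hφ.mem_inversions_simple_mul_iff hβ.1 hβt).1 hβ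
      obtain ⟨a, b, ha, hb, hab⟩ := exists_coeff_of_mem_cone_pair (hw h1)
      have h2 : β = D.action cs (cs.simple t) (a • D.root r + b • D.root s) := by
        rw [← hab, action_simple_action_simple]
      have h3 := hβ.1.1
      -- The simple reflections of `r` and `s` preserve the plane of `α_r` and `α_s`, so `β` is a
      -- positive root in it.
      obtain ⟨a', b', h4⟩ : ∃ a' b' : ℝ, β = a' • D.root r + b' • D.root s := by
        rw [h2, action_simple]
        generalize 2 * D.form (D.root t) (a • D.root r + b • D.root s) = c
        rcases ht with rfl | rfl
        · exact ⟨a - c, b, by module⟩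
        · exact ⟨a, b - c, by module⟩
      rw [h4] at h3 ⊢
      exact D.mem_cone_pair hrs h3
  obtain ⟨w, hw, hmax⟩ := (measure fun w => cs.length h - cs.length w).wf.has_min Q
    ⟨1, by simp [Q, hφ.inversions_one]⟩
  have hdesc : ∀ t, t = r ∨ t = s → cs.IsLeftDescent w t := by
    intro t ht
    by_contra hd
    rw [cs.not_isLeftDescent_iff] at hd
    have h1 := hQmul w hw t ht
    have h2 := hQlen _ h1
    apply hmax _ h1
    change cs.length h - cs.length (cs.simple t * w) < cs.length h - cs.length w
    omega
  exact ⟨w, hφ.root_mem_inversions_iff.2 (hdesc r (.inl rfl)),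
    hφ.root_mem_inversions_iff.2 (hdesc s (.inr rfl)), hw⟩

theorem mem_inversionsOf {X : Set W} {β : V} :
    β ∈ D.inversionsOf cs X ↔ ∃ x ∈ X, β ∈ D.inversions cs x := by
  simp [inversionsOf]

/-- The induction step for elements with a common left descent, which is removed from all of
them. -/
theorem IsTransverse.exists_inversions_of_common_descent (hφ : D.IsTransverse cs φ) {h : W} {s : S}
    (ih : ∀ h', cs.length h' < cs.length h → ∀ X, D.inversionsOf cs X ⊆ D.inversions cs h' →
      ∃ g, D.inversionsOf cs X ⊆ D.inversions cs g ∧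
        D.inversions cs g ⊆ cone (D.inversionsOf cs X))
    {X : Set W} (hX : D.inversionsOf cs X ⊆ D.inversions cs h) (hne : X.Nonempty)
    (hs : ∀ x ∈ X, D.root s ∈ D.inversions cs x) :
    ∃ g, D.inversionsOf cs X ⊆ D.inversions cs g ∧
      D.inversions cs g ⊆ cone (D.inversionsOf cs X) := by
  obtain ⟨x₀, hx₀⟩ := hne
  have hsX : D.root s ∈ D.inversionsOf cs X := mem_inversionsOf.2 ⟨x₀, hx₀, hs x₀ hx₀⟩
  have hdh := hφ.root_mem_inversions_iff.1 (hX hsX)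
  have hsub : D.inversionsOf cs ((cs.simple s * ·) '' X) ⊆
      D.inversions cs (cs.simple s * h) := by
    intro β hβ
    obtain ⟨_, ⟨x, hx, rfl⟩, hβ⟩ := mem_inversionsOf.1 hβ
    exact hφ.inversions_simple_mul_subset (hs x hx)
      (fun γ hγ => hX (mem_inversionsOf.2 ⟨x, hx, hγ⟩)) hβ
  have hsh : D.root s ∉ D.inversions cs (cs.simple s * h) := by
    rw [hφ.root_mem_inversions_iff]
    exact cs.isLeftDescent_iff_not_isLeftDescent_mul.1 hdh
  obtain ⟨g, hg1, hg2⟩ := ih (cs.simple s * h) hdh _ hsub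
  have hsg : D.root s ∈ D.inversions cs (cs.simple s * g) := by
    rw [hφ.root_mem_inversions_iff, cs.isLeftDescent_iff_not_isLeftDescent_mul,
      cs.simple_mul_simple_cancel_left, ← hφ.root_mem_inversions_iff]
    exact fun hcon => hsh (hφ.mem_inversions_of_mem_cone hsub hcon.1.2 (hg2 hcon))
  refine ⟨cs.simple s * g, fun β hβ => ?_, fun β hβ => ?_⟩
  · obtain ⟨x, hx, hβx⟩ := mem_inversionsOf.1 hβ
    by_cases hβs : β = D.root s
    · rwa [hβs]
    · rw [hφ.mem_inversions_simple_mul_iff hβx.1 hβs]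
      refine hg1 (mem_inversionsOf.2 ⟨_, ⟨x, hx, rfl⟩, ?_⟩)
      rw [← hφ.mem_inversions_simple_mul_iff hβx.1 hβs]
      simpa using hβx
  · by_cases hβs : β = D.root s
    · exact subset_cone _ (hβs ▸ hsX)
    · have h1 := hg2 ((hφ.mem_inversions_simple_mul_iff hβ.1 hβs).1 hβ)
      have h2 := map_mem_cone_image (D.action cs (cs.simple s)).toLinearMap h1
      rw [LinearEquiv.coe_coe, action_simple_action_simple] at h2
      refine cone_subset_cone ?_ h2
      rintro _ ⟨γ, hγ, rfl⟩
      obtain ⟨_, ⟨x, hx, rfl⟩, hγx⟩ := mem_inversionsOf.1 hγ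
      have hγs : γ ≠ D.root s := fun hcon => hsh (hcon ▸ hsub hγ)
      exact subset_cone _ (mem_inversionsOf.2
        ⟨x, hx, (hφ.mem_inversions_simple_mul_iff hγx.1 hγs).1 hγx⟩)

/-- The roots in the cone of the inversions of a bounded set form an inversion set. The induction
is on the length of the bound `h`. After a simple root `α_s` in `N(X)` has been fixed, every
`x ∈ X` is replaced by the join of `x` and `s`, which has `s` as a left descent and whose inversions
lie in the cone of `N(x)` and `α_s`. If `x` has a left descent `r ≠ s`, this join is the join of `x`
and the longest element of the parabolic subgroup of `r` and `s`; these have the common left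
descent `r`. -/
theorem IsTransverse.exists_inversions_subset_cone (hφ : D.IsTransverse cs φ) {h : W} {X : Set W}
    (hX : D.inversionsOf cs X ⊆ D.inversions cs h) :
    ∃ g, D.inversionsOf cs X ⊆ D.inversions cs g ∧
      D.inversions cs g ⊆ cone (D.inversionsOf cs X) := by
  induction hn : cs.length h using Nat.strong_induction_on generalizing h X with
  | _ n ih =>
  subst hn
  replace ih : ∀ h', cs.length h' < cs.length h → ∀ X, D.inversionsOf cs X ⊆ D.inversions cs h' →
      ∃ g, D.inversionsOf cs X ⊆ D.inversions cs g ∧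
        D.inversions cs g ⊆ cone (D.inversionsOf cs X) :=
    fun h' hlt X hX => ih _ hlt hX rfl
  by_cases htriv : ∀ x ∈ X, x = 1
  · refine ⟨1, fun β hβ => ?_, by simp [hφ.inversions_one]⟩
    obtain ⟨x, hx, hβ⟩ := mem_inversionsOf.1 hβ
    rwa [htriv x hx] at hβ
  push Not at htriv
  obtain ⟨x₀, hx₀, hx₀1⟩ := htriv
  obtain ⟨s, hs⟩ := cs.exists_leftDescent_of_ne_one hx₀1
  rw [← hφ.root_mem_inversions_iff] at hs
  have hsX : D.root s ∈ D.inversionsOf cs X := mem_inversionsOf.2 ⟨x₀, hx₀, hs⟩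
  have hstep : ∀ x ∈ X, ∃ y, D.inversions cs x ⊆ D.inversions cs y ∧
      D.root s ∈ D.inversions cs y ∧
      D.inversions cs y ⊆ cone (insert (D.root s) (D.inversions cs x)) := by
    intro x hx
    have hxh : D.inversions cs x ⊆ D.inversions cs h :=
      fun β hβ => hX (mem_inversionsOf.2 ⟨x, hx, hβ⟩)
    by_cases hsx : D.root s ∈ D.inversions cs x
    · exact ⟨x, subset_rfl, hsx, fun β hβ => subset_cone _ (.inr hβ)⟩
    by_cases hx1 : x = 1
    · subst hx1
      refine ⟨cs.simple s, by simp [hφ.inversions_one], ?_, fun β hβ => ?_⟩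
      · rw [hφ.root_mem_inversions_iff, cs.isLeftDescent_iff]
        simp
      · by_cases hβs : β = D.root s
        · exact subset_cone _ (.inl hβs)
        · rw [← mul_one (cs.simple s), hφ.mem_inversions_simple_mul_iff hβ.1 hβs,
            hφ.inversions_one] at hβ
          exact hβ.elim
    obtain ⟨r, hr⟩ := cs.exists_leftDescent_of_ne_one hx1
    rw [← hφ.root_mem_inversions_iff] at hr
    have hrs : r ≠ s := by
      rintro rfl
      exact hsx hr
    obtain ⟨w, hwr, hws, hwc⟩ := hφ.exists_inversions_subset_cone_pair hrs (hxh hr) (hX hsX)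
    have hpair : ({D.root r, D.root s} : Set V) ⊆ insert (D.root s) (D.inversions cs x) := by
      rintro _ (rfl | rfl)
      · exact .inr hr
      · exact .inl rfl
    have hwh : D.inversions cs w ⊆ D.inversions cs h := fun β hβ =>
      hφ.mem_inversions_of_mem_cone (hpair.trans (Set.insert_subset (hX hsX) hxh)) hβ.1.2 (hwc hβ)
    obtain ⟨y, hy1, hy2⟩ := hφ.exists_inversions_of_common_descent (s := r) ih (X := {x, w})
      (by
        intro β hβ
        obtain ⟨_, rfl | rfl, hβ'⟩ := mem_inversionsOf.1 hβ
        · exact hxh hβ'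
        · exact hwh hβ')
      ⟨x, by simp⟩ (by rintro _ (rfl | rfl) <;> assumption)
    refine ⟨y, fun β hβ => hy1 (mem_inversionsOf.2 ⟨x, by simp, hβ⟩),
      hy1 (mem_inversionsOf.2 ⟨w, by simp, hws⟩), hy2.trans (cone_subset_cone fun β hβ => ?_)⟩
    obtain ⟨_, rfl | rfl, hβ'⟩ := mem_inversionsOf.1 hβ
    · exact subset_cone _ (.inr hβ')
    · exact cone_subset_cone (hpair.trans (subset_cone _)) (hwc hβ')
  choose! y hy1 hy2 hy3 using hstep
  have hyX : D.inversionsOf cs (y '' X) ⊆ cone (D.inversionsOf cs X) := by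
    intro β hβ
    obtain ⟨_, ⟨x, hx, rfl⟩, hβ⟩ := mem_inversionsOf.1 hβ
    refine cone_subset_cone ?_ (hy3 x hx hβ)
    exact Set.insert_subset (subset_cone _ hsX)
      fun γ hγ => subset_cone _ (mem_inversionsOf.2 ⟨x, hx, hγ⟩)
  obtain ⟨g, hg1, hg2⟩ := hφ.exists_inversions_of_common_descent (s := s) ih (X := y '' X)
    (fun β hβ => hφ.mem_inversions_of_mem_cone hX
      (by obtain ⟨_, -, hβ⟩ := mem_inversionsOf.1 hβ; exact hβ.1.2) (hyX hβ))
    (Set.Nonempty.image _ ⟨x₀, hx₀⟩) (by rintro _ ⟨x, hx, rfl⟩; exact hy2 x hx)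
  refine ⟨g, fun β hβ => ?_, hg2.trans (cone_subset_cone hyX)⟩
  obtain ⟨x, hx, hβ⟩ := mem_inversionsOf.1 hβ
  exact hg1 (mem_inversionsOf.2 ⟨_, ⟨x, hx, rfl⟩, hy1 x hx hβ⟩)

theorem IsTransverse.exists_isJoin (hφ : D.IsTransverse cs φ) {X : Set W} (hX : Bounded cs X) :
    ∃ g, IsJoin cs X g ∧ D.inversions cs g = D.rootCone cs (D.inversionsOf cs X) := by
  obtain ⟨h, hh⟩ := hX
  obtain ⟨g, hg1, hg2⟩ := hφ.exists_inversions_subset_cone (hφ.isUpperBound_iff.1 hh)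
  refine ⟨g, ⟨hφ.isUpperBound_iff.2 hg1, fun h' hh' => hφ.weakLE_iff.2 fun β hβ => ?_⟩, ?_⟩
  · exact hφ.mem_inversions_of_mem_cone (hφ.isUpperBound_iff.1 hh') hβ.1.2 (hg2 hβ)
  · exact Set.Subset.antisymm (fun β hβ => ⟨hg2 hβ, hβ.1.2⟩)
      fun β hβ => hφ.mem_inversions_of_mem_cone hg1 hβ.2 hβ.1

theorem IsTransverse.inversions_eq_of_isJoin (hφ : D.IsTransverse cs φ) {X : Set W} {g : W}
    (hg : IsJoin cs X g) : D.inversions cs g = D.rootCone cs (D.inversionsOf cs X) := by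
  obtain ⟨g', hg', heq⟩ := hφ.exists_isJoin ⟨g, hg.1⟩
  rw [← heq]
  exact Set.Subset.antisymm (hφ.weakLE_iff.1 (hg.2 g' hg'.1)) (hφ.weakLE_iff.1 (hg'.2 g hg.1))

/-! ### Normalized roots and limit roots -/

theorem map_normalize (f : Module.Dual ℝ V) (v : V) : f (normalize φ v) = (φ v)⁻¹ * f v := by
  rw [normalize, map_smul, smul_eq_mul]

theorem IsTransverse.map_normalize_neg_iff (hφ : D.IsTransverse cs φ) (f : Module.Dual ℝ V) {β : V}
    (hβ : β ∈ D.posRoots cs) : f (normalize φ β) < 0 ↔ f β < 0 := by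
  rw [map_normalize]
  have := inv_pos.2 (hφ β hβ)
  exact ⟨fun h => by nlinarith, fun h => mul_neg_of_pos_of_neg this h⟩

/-- Opposite roots have the same normalization, so the positive roots suffice. -/
theorem normalizedRoots_eq : D.normalizedRoots cs φ = normalize φ '' D.posRoots cs := by
  apply Set.Subset.antisymm
  · rintro _ ⟨β, hβ, rfl⟩
    rcases D.mem_posRoots_or_neg_mem cs hβ with h | h
    · exact ⟨β, h, rfl⟩
    · exact ⟨-β, h, by simp [normalize, inv_neg]⟩
  · exact Set.image_mono fun β hβ => hβ.2

theorem IsTransverse.injOn_normalize (hφ : D.IsTransverse cs φ) :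
    Set.InjOn (normalize φ) (D.posRoots cs) := by
  intro β hβ γ hγ h
  have hb := hφ β hβ
  have hc := hφ γ hγ
  have h1 : β = (φ β * (φ γ)⁻¹) • γ := by
    rw [mul_smul, ← normalize, ← h, normalize, smul_inv_smul₀ hb.ne']
  have hpos : 0 < φ β * (φ γ)⁻¹ := by positivity
  have h2 := D.form_self_of_mem_roots cs hβ.2
  generalize φ β * (φ γ)⁻¹ = c at h1 hpos
  rw [h1] at h2
  simp only [map_smul, LinearMap.smul_apply, smul_eq_mul, D.form_self_of_mem_roots cs hγ.2] at h2
  have : c = 1 := by nlinarith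
  rw [h1, this, one_smul]

theorem IsTransverse.normalizedRoots_subset (hφ : D.IsTransverse cs φ) :
    D.normalizedRoots cs φ ⊆ convexHull ℝ (Set.range fun s => normalize φ (D.root s)) := by
  rw [normalizedRoots_eq]
  rintro _ ⟨β, hβ, rfl⟩
  obtain ⟨a, ha, hsum⟩ := D.exists_coeff_of_mem_cone hβ.1
  have hb := hφ β hβ
  have hs : ∀ s, 0 < φ (D.root s) := fun s => hφ _ (D.root_mem_posRoots cs s)
  have heq : normalize φ β =
      ∑ s, ((φ β)⁻¹ * (a s * φ (D.root s))) • normalize φ (D.root s) := by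
    rw [normalize]
    conv_lhs => rw [hsum, Finset.smul_sum]
    rw [← hsum]
    refine Finset.sum_congr rfl fun s _ => ?_
    rw [normalize, smul_smul, smul_smul]
    have := (hs s).ne'
    congr 1
    field_simp
  rw [heq]
  refine (convex_convexHull ℝ _).sum_mem (fun s _ => ?_) ?_
    fun s _ => subset_convexHull ℝ _ ⟨s, rfl⟩
  · exact mul_nonneg (inv_nonneg.2 hb.le) (mul_nonneg (ha s) (hs s).le)
  · rw [← Finset.mul_sum]
    have : φ β = ∑ s, a s * φ (D.root s) := by
      conv_lhs => rw [hsum]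
      simp
    rw [← this, inv_mul_cancel₀ hb.ne']

end SimpleSystem

/-! ### Separation from the limit roots -/

namespace SimpleSystem

variable {S W V : Type*} [Fintype S] [Group W] [NormedAddCommGroup V] [NormedSpace ℝ V]
  {M : CoxeterMatrix S} {D : SimpleSystem M V}
  {cs : CoxeterSystem M W} {φ : Module.Dual ℝ V}

variable (D φ) in
theorem isCompact_convexHull_range_root :
    IsCompact (convexHull ℝ (Set.range fun s => normalize φ (D.root s))) :=
  (Set.finite_range _).isCompact_convexHull ℝ

variable [FiniteDimensional ℝ V]

theorem IsTransverse.map_limitRoots (hφ : D.IsTransverse cs φ) {x : V}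
    (hx : x ∈ D.limitRoots cs φ) : φ x = 1 := by
  have hclosed : IsClosed {v | φ v = 1} :=
    isClosed_eq φ.continuous_of_finiteDimensional continuous_const
  refine closure_minimal ?_ hclosed (derivedSet_subset_closure _ hx)
  rw [normalizedRoots_eq]
  rintro _ ⟨β, hβ, rfl⟩
  change φ (normalize φ β) = 1
  rw [map_normalize, inv_mul_cancel₀ (hφ β hβ).ne']

theorem IsTransverse.isCompact_imaginaryConvexBody (hφ : D.IsTransverse cs φ) :
    IsCompact (D.imaginaryConvexBody cs φ) := by
  refine IsCompact.convexHull ((isCompact_convexHull_range_root D φ).of_isClosed_subset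
    (isClosed_derivedSet _) ?_)
  exact (derivedSet_subset_closure _).trans
    (closure_minimal hφ.normalizedRoots_subset (isCompact_convexHull_range_root D φ).isClosed)

/-- By compactness, an open half-space whose closure contains no limit root contains only finitely
many positive roots. -/
theorem IsTransverse.finite_of_pos_on_limitRoots (hφ : D.IsTransverse cs φ) (ψ : Module.Dual ℝ V)
    (hψ : ∀ x ∈ D.limitRoots cs φ, 0 < ψ x) : {β ∈ D.posRoots cs | ψ β < 0}.Finite := by
  refine Set.Finite.of_finite_image ?_ (hφ.injOn_normalize.mono fun β hβ => hβ.1)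
  by_contra hinf
  set T := normalize φ '' {β ∈ D.posRoots cs | ψ β < 0}
  have hT : T ⊆ D.normalizedRoots cs φ := Set.image_mono fun β hβ => hβ.1.2
  obtain ⟨x, -, hx⟩ := Set.Infinite.exists_accPt_of_subset_isCompact hinf
    (isCompact_convexHull_range_root D φ) (hT.trans hφ.normalizedRoots_subset)
  have hpos := hψ x (derivedSet_mono _ _ hT hx)
  have hclosed : IsClosed {v | ψ v ≤ 0} :=
    isClosed_le ψ.continuous_of_finiteDimensional continuous_const
  have hle : ψ x ≤ 0 := by
    refine closure_minimal ?_ hclosed (derivedSet_subset_closure T hx)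
    rintro _ ⟨β, ⟨hβ, hneg⟩, rfl⟩
    exact ((hφ.map_normalize_neg_iff ψ hβ).2 hneg).le
  linarith

/-- The linear form `φ ∘ g⁻¹` is non-negative on the limit roots, since only the finitely many
roots in `N(g)` are on its negative side. -/
theorem IsTransverse.nonneg_limitRoots (hφ : D.IsTransverse cs φ) (g : W) {x : V}
    (hx : x ∈ D.limitRoots cs φ) : 0 ≤ φ (D.action cs g⁻¹ x) := by
  let f : Module.Dual ℝ V := φ ∘ₗ (D.action cs g⁻¹).toLinearMap
  have hsub : D.normalizedRoots cs φ ⊆ normalize φ '' D.inversions cs g ∪ {v | 0 ≤ f v} := by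
    rw [normalizedRoots_eq]
    rintro _ ⟨β, hβ, rfl⟩
    by_cases h : f β < 0
    · exact .inl ⟨β, hφ.mem_inversions_iff.2 ⟨hβ, h⟩, rfl⟩
    · right
      by_contra! hneg
      exact h ((hφ.map_normalize_neg_iff f hβ).1 (not_le.1 hneg))
  have hx' := derivedSet_mono _ _ hsub hx
  rw [derivedSet_union] at hx'
  rcases hx' with h | h
  · exact absurd ((hφ.inversions_finite g).image (normalize φ)) (Set.Infinite.of_accPt h)
  · exact (isClosed_iff_derivedSet_subset _).1
      (isClosed_le continuous_const f.continuous_of_finiteDimensional) h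

/-- A bounded set is separated from the limit roots by `φ ∘ g⁻¹`, where `g` is an upper bound. -/
theorem IsTransverse.strictlySeparated_of_bounded [Nonempty S] (hφ : D.IsTransverse cs φ)
    {X : Set W} (hX : Bounded cs X) :
    StrictlySeparated (D.convInversions cs φ X) (D.imaginaryConvexBody cs φ) := by
  have hfin := hφ.inversionsOf_finite hX.finite
  obtain ⟨g, hg⟩ := hX
  rw [hφ.isUpperBound_iff] at hg
  let f : Module.Dual ℝ V := φ ∘ₗ (D.action cs g⁻¹).toLinearMap
  have hneg : ∀ x ∈ normalize φ '' D.inversionsOf cs X, f x < 0 := by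
    rintro _ ⟨β, hβ, rfl⟩
    have h := hφ.mem_inversions_iff.1 (hg hβ)
    exact (hφ.map_normalize_neg_iff f h.1).2 h.2
  -- A finite set of negative numbers has a negative strict upper bound.
  obtain ⟨c, hc, hc0⟩ : ∃ c, (∀ x ∈ normalize φ '' D.inversionsOf cs X, f x < c) ∧ c < 0 := by
    have h := (Filter.eventually_all_finite (hfin.image (normalize φ))).2
      fun x hx => (eventually_gt_nhds (hneg x hx)).filter_mono
        (nhdsWithin_le_nhds (s := Set.Iio (0 : ℝ)))
    exact (h.and self_mem_nhdsWithin).exists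
  refine ⟨f, c, ?_, ?_, ?_⟩
  · intro h0
    obtain ⟨s⟩ := ‹Nonempty S›
    have h1 := hφ _ (D.root_mem_posRoots cs s)
    have h2 := LinearMap.congr_fun h0 (D.action cs g (D.root s))
    simp only [f, LinearMap.comp_apply, LinearEquiv.coe_coe, action_inv_action,
      LinearMap.zero_apply] at h2
    linarith
  · exact fun x hx => convexHull_min (t := {v | f v < c}) hc
      (convex_halfSpace_lt f.isLinear c) hx
  · exact fun x hx => hc0.trans_le <| convexHull_min (t := {v | 0 ≤ f v})
      (fun y hy => hφ.nonneg_limitRoots g hy) (convex_halfSpace_ge f.isLinear 0) hx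

/-- If a hyperplane separates the inversions of `X` from the limit roots, then the positive roots
on the side of the inversions form a finite set cut out by a linear half-space, hence the inversion
set of an upper bound. -/
theorem IsTransverse.bounded_of_disjoint (hφ : D.IsTransverse cs φ) {X : Set W} (hX : X.Finite)
    (hdisj : D.convInversions cs φ X ∩ D.imaginaryConvexBody cs φ = ∅) : Bounded cs X := by
  have hcomp : IsCompact (D.convInversions cs φ X) :=
    ((hφ.inversionsOf_finite hX).image _).isCompact_convexHull ℝ
  obtain ⟨f, u, v, hu, huv, hv⟩ := geometric_hahn_banach_compact_closed (convex_convexHull ℝ _)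
    hcomp (convex_convexHull ℝ _) hφ.isCompact_imaginaryConvexBody.isClosed
    (Set.disjoint_iff_inter_eq_empty.2 hdisj)
  -- On `V₁` the affine form `f - u` agrees with the linear form `f - u φ`.
  let ψ : Module.Dual ℝ V := f.toLinearMap - u • φ
  have hψ : ∀ x, ψ x = f x - u * φ x := fun x => by simp [ψ]
  have hfin := hφ.finite_of_pos_on_limitRoots ψ fun x hx => by
    rw [hψ, hφ.map_limitRoots hx]
    linarith [hv x (subset_convexHull ℝ _ hx)]
  obtain ⟨g, hg⟩ := hφ.exists_inversions_eq ψ hfin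
  refine ⟨g, hφ.isUpperBound_iff.2 fun β hβ => ?_⟩
  obtain ⟨x, -, hβx⟩ := mem_inversionsOf.1 hβ
  rw [hg]
  refine ⟨hβx.1, (hφ.map_normalize_neg_iff ψ hβx.1).1 ?_⟩
  have h1 := hu _ (subset_convexHull ℝ _ ⟨β, hβ, rfl⟩)
  have h2 : φ (normalize φ β) = 1 := by rw [map_normalize, inv_mul_cancel₀ (hφ β hβx.1).ne']
  rw [hψ, h2]
  linarith

end SimpleSystem

theorem StrictlySeparated.inter_eq_empty {V : Type*} [AddCommGroup V] [Module ℝ V] {A B : Set V}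
    (h : StrictlySeparated A B) : A ∩ B = ∅ := by
  obtain ⟨f, c, -, hA, hB⟩ := h
  rw [Set.eq_empty_iff_forall_notMem]
  rintro x ⟨hxA, hxB⟩
  exact lt_asymm (hA x hxA) (hB x hxB)

end CoxeterJoin

theorem mainTheorem1 {S W V : Type*} [Fintype S] [Nonempty S] [Group W]
    [NormedAddCommGroup V] [NormedSpace ℝ V] [FiniteDimensional ℝ V]
    (M : CoxeterMatrix S) (cs : CoxeterSystem M W)
    (D : CoxeterJoin.SimpleSystem M V)
    (φ : Module.Dual ℝ V) (hφ : D.IsTransverse cs φ) (X : Set W) :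
    List.TFAE [
      ∃ g, CoxeterJoin.IsJoin cs X g,
      CoxeterJoin.Bounded cs X,
      X.Finite ∧ D.convInversions cs φ X ∩ D.imaginaryConvexBody cs φ = ∅,
      X.Finite ∧ CoxeterJoin.StrictlySeparated
        (D.convInversions cs φ X) (D.imaginaryConvexBody cs φ)] ∧
    ∀ g, CoxeterJoin.IsJoin cs X g →
      D.inversions cs g = D.rootCone cs (D.inversionsOf cs X) := by
  refine ⟨?_, fun g hg => hφ.inversions_eq_of_isJoin hg⟩
  tfae_have 1 → 2 := fun ⟨g, hg⟩ => ⟨g, hg.1⟩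
  tfae_have 2 → 1 := fun h => (hφ.exists_isJoin h).imp fun _ hg => hg.1
  tfae_have 2 → 4 := fun h => ⟨h.finite, hφ.strictlySeparated_of_bounded h⟩
  tfae_have 4 → 3 := fun h => ⟨h.1, h.2.inter_eq_empty⟩
  tfae_have 3 → 2 := fun h => hφ.bounded_of_disjoint h.1 h.2
  tfae_finish
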